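/- **Conventions.** Let $\kappa\ge 1$ and $c_2$ be integers. Write $\tau_2=\operatorname{Im}\tau$ for $\tau\in\mathbb H$. A *charge vector* is a tuple $\boldsymbol r=(r_1,\dots,r_n)$ of positive integers, $r=\sum_i r_i$; $\boldsymbol\mu=(\mu_1,\dots,\mu_n)$ denotes integers $0\le\mu_i<\kappa r_i$, and $0\le\mu<\kappa r$ (representatives of residues mod $\kappa r_i$, $\kappa r$). Sums over $\sum_{i=1}^n r_i=r$ run over ordered decompositions into positive integers. A finite vector $F=(F_i)$ of functions on $\mathbb H$ *transforms with weight* $k\in\frac12\mathbb Z$ *and multiplier system* $M=(M(T),M(S))$ if $F_i(\tau+1)=\sum_jM_{ij}(T)F_j(\tau)$ and $F_i(-1/\tau)=\tau^k\sum_jM_{ij}(S)F_j(\tau)$ (principal branch). A *holomorphic modular form* is such an $F$ that is holomorphic on $\mathbb H$ and $O(e^{2\pi N\tau_2})$ as $\tau_2\to\infty$ for some $N$ (weakly holomorphic). *Mock modular forms of depth $d$*, with their completions, are defined recursively. A completion of $h=(h_i)$ is a vector of functions $\widehat h_i(\tau,\bar\tau)$ obtained by setting $w=\bar\tau$ in functions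 $\widehat h_i(\tau,w)$, $\operatorname{Im}\tau>0>\operatorname{Im}w$. Depth $0$: $h$ is a holomorphic modular form and $\widehat h=h$. Depth $d+1$: $h$ is holomorphic on $\mathbb H$ and $O(e^{2\pi N\tau_2})$ for some $N$; $\widehat h(\tau,\bar\tau)$ transforms with the weight $k$ and multiplier system of $h$; $\widehat h_i(\tau,w)$ is holomorphic in $\tau$ and in $w$; $\widehat h_i(\tau,x-\mathrm iy)\to h_i(\tau)$ as $y\to+\infty$ for all $\tau\in\mathbb H$, $x\in\mathbb R$; and $$\partial_w\widehat h_i(\tau,w)=-2\pi\mathrm i\sum_j\bigl(-2\pi\mathrm i(\tau-w)\bigr)^{\rho_j}\sum_{a,b}L^{(j)}_{i,a,b}\,\widehat f_{j,a}(\tau,w)\,\overline{g_{j,b}(\bar w)},$$ a finite sum in which $\widehat f_j$ is the completion of a mock modular form of depth $d$ and weight $k+\rho_j$, $g_j$ is a holomorphic modular form of weight $2+\rho_j$, $\rho_j\in\frac12\mathbb Z$, and the constant tensor $L^{(j)}$ is equivariant: $M L^{(j)}=L^{(j)}(M_{f_j}\otimes\overline{M_{g_j}})$ for $T$ and for $S$.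 (For $w=\bar\tau$ one has $-2\pi\mathrm i(\tau-w)=4\pi\tau_2$.) The multiplier systems are allowed to be arbitrary finite matrices. **The theta series $R$.** For charges $\hat\gamma_i=(r_i,q_i)$ and weights $\kappa r_i$ put $\boldsymbol x\cdot\boldsymbol y=\sum_i\kappa r_ix_iy_i$ on $\mathbb R^n$, and let $v_{ij}$ be the vector with $k$-th component $\delta_{ki}r_j-\delta_{kj}r_i$. For a tree $\mathcal T$ on the vertices $1,\dots,n$ and an oriented edge $e:s\to t$ let $v_e=\sum_{i\in\mathcal T_e^s}\sum_{j\in\mathcal T_e^t}v_{ij}$, where $\mathcal T^s_e\ni s$, $\mathcal T_e^t\ni t$ are the components of $\mathcal T\setminus e$. Let $$\Phi^E_{\mathcal T}(\boldsymbol x)=\int_{\mathbb R^{m}}e^{-\pi\sum_i(u_i-u_i')^2}\prod_{e}\operatorname{sgn}\bigl((\mathcal B\cdot\mathcal V)^{\rm tr}u'\bigr)_e\,du',\qquad u=\mathcal B\cdot\boldsymbol x,$$ where $\mathcal V=(v_e)_e$, the rows of $\mathcal B$ form an orthonormal basis of the $m$-dimensional span of the $v_e$, and $\operatorname{sgn}(0)=0$.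 With $\mathcal D(v,\boldsymbol y)=v\cdot\bigl(\boldsymbol y+\tfrac1{2\pi}\partial_{\boldsymbol x}\bigr)$ (so $v\cdot\partial_{\boldsymbol x}$ is the derivative in the direction $v$) put $$\mathscr E_n(\hat\gamma_1,\dots,\hat\gamma_n;\tau_2)=\frac{1}{n!\,(\sqrt{2\tau_2})^{n-1}}\sum_{\mathcal T}\Bigl[\prod_{e}\mathcal D(v_{s(e)t(e)},\boldsymbol y)\Bigr]\Phi^E_{\mathcal T}(\boldsymbol x)\Big|_{\boldsymbol y=\boldsymbol x},\qquad x_i=\sqrt{2\tau_2}\,\frac{q_i}{\kappa r_i},$$ the sum being over all trees on $\{1,\dots,n\}$ (the orientations are immaterial). Let $\mathscr E^{(0)}_n=\lim_{\tau_2\to\infty}\mathscr E_n$ at fixed charges and $\mathscr E_n^{(+)}=\mathscr E_n-\mathscr E_n^{(0)}$. Put $\mathscr R_1=1$ and, for $n\ge2$, $$\mathscr R_n(\hat\gamma_1,\dots,\hat\gamma_n;\tau_2)=\frac1{2^{n-1}}\sum_{T}(-1)^{n_T-1}\mathscr E^{(+)}_{v_0}\prod_{v\ne v_0}\mathscr E^{(0)}_v,$$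 the sum being over planar rooted trees with $n$ leaves, labeled by $\hat\gamma_1,\dots,\hat\gamma_n$ from left to right, all of whose $n_T$ non-leaf vertices have at least two children; $v_0$ is the root, $v$ runs over the other non-leaf vertices, $\mathscr E_v$ is $\mathscr E$ evaluated at the charges of the children of $v$, and the charge of a non-leaf vertex is the sum of the charges of its children. Finally $$R^{(\boldsymbol r)}_{\mu,\boldsymbol\mu}(\tau,\bar\tau)=\sum_{\substack{q_1+\dots+q_n=\mu\\ q_i\in\kappa r_i\mathbb Z+\mu_i}}\operatorname{Sym}\{\mathscr R_n(\hat\gamma_1,\dots,\hat\gamma_n;\tau_2)\}\,e^{\pi\mathrm i\tau Q_n},\qquad Q_n=\frac{(\sum_iq_i)^2}{\kappa r}-\sum_i\frac{q_i^2}{\kappa r_i},$$ where $\operatorname{Sym}$ is the average over the $n!$ permutations. **Multiplier systems.** Let $M^{(r)}$ be $$M^{(r)}_{\mu\nu}(T)=e^{\frac{\pi\mathrm i}{\kappa r}(1-\kappa r)\mu^2+\frac{\pi\mathrm i}4(\kappa+\frac{c_2}3)r}\delta_{\mu\nu},\qquad M^{(r)}_{\mu\nu}(S)=\frac{e^{\frac{\pi\mathrm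 i}4((2\kappa+c_2)r-1)}}{\sqrt{\kappa r}}e^{-2\pi\mathrm i\frac{\mu\nu}{\kappa r}},$$ and let $M^{(\boldsymbol r)}$, for a charge vector with $n$ entries, be $$M^{(\boldsymbol r)}_{\mu\boldsymbol\mu,\nu\boldsymbol\nu}(T)=e^{\pi\mathrm i(\mu-\sum_i\mu_i)+\pi\mathrm i\left(\frac{\mu^2}{\kappa r}-\sum_i\frac{\mu_i^2}{\kappa r_i}\right)}\delta_{\mu\nu}\delta_{\boldsymbol\mu\boldsymbol\nu},\qquad M^{(\boldsymbol r)}_{\mu\boldsymbol\mu,\nu\boldsymbol\nu}(S)=\frac{e^{\frac{\pi\mathrm i}4(n-1)}}{\sqrt{\kappa^{n+1}r\prod_ir_i}}e^{-2\pi\mathrm i\left(\frac{\mu\nu}{\kappa r}-\sum_i\frac{\mu_i\nu_i}{\kappa r_i}\right)}.$$ **Theorem.** For every $r\ge1$ let $h^{(0)}_r=(h^{(0)}_{r,\mu})_\mu$ be a holomorphic modular form of weight $-\frac32$ and multiplier system $M^{(r)}$. Let $g^{(\boldsymbol r)}_{\mu,\boldsymbol\mu}$ be functions on $\mathbb H$,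 indexed by all charge vectors $\boldsymbol r$, with $g^{(r)}_{\mu,\mu'}=\delta_{\mu,\mu'}$, such that for every $n\ge1$ and every charge vector $\boldsymbol r$ with $n$ entries $g^{(\boldsymbol r)}$ is a mock modular form of depth $n-1$, weight $\frac32(n-1)$ and multiplier system $M^{(\boldsymbol r)}$, with completion $$\widehat g^{(\boldsymbol r)}_{\mu,\boldsymbol\mu}=\operatorname{Sym}\Bigl\{\sum_{m=1}^n\ \sum_{n_1+\dots+n_m=n}\ \sum_{\boldsymbol\nu}R^{(\boldsymbol s)}_{\mu,\boldsymbol\nu}\prod_{k=1}^m g^{(\mathfrak r_k)}_{\nu_k,\mathfrak m_k}\Bigr\}.$$ Here the $n_k$ are positive, $\mathfrak r_k=(r_{j_k+1},\dots,r_{j_{k+1}})$ and $\mathfrak m_k=(\mu_{j_k+1},\dots,\mu_{j_{k+1}})$ with $j_k=n_1+\dots+n_{k-1}$, $s_k$ is the sum of the entries of $\mathfrak r_k$, $\boldsymbol\nu$ runs over $0\le\nu_k<\kappa s_k$, and $\operatorname{Sym}$ is the average over simultaneous permutations of the $(r_i,\mu_i)$. (Equivalently, the sum is over rooted trees of depth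 2 with leaves labeled by the $r_i$.) Put $$\tilde h_{r,\mu}(\tau)=\sum_{n=1}^r\ \sum_{r_1+\dots+r_n=r}\ \sum_{\boldsymbol\mu}g^{(\boldsymbol r)}_{\mu,\boldsymbol\mu}(\tau)\prod_{i=1}^nh^{(0)}_{r_i,\mu_i}(\tau).$$ Then for every $r\ge1$ the vector $\tilde h_r=(\tilde h_{r,\mu})_\mu$ is a mock modular form of depth $r-1$, weight $-\frac32$ and multiplier system $M^{(r)}$, with completion $$\widehat{\tilde h}_{r,\mu}(\tau,\bar\tau)=\sum_{n=1}^r\ \sum_{r_1+\dots+r_n=r}\ \sum_{\boldsymbol\mu}R^{(\boldsymbol r)}_{\mu,\boldsymbol\mu}(\tau,\bar\tau)\prod_{i=1}^n\tilde h_{r_i,\mu_i}(\tau).$$ -/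

import Mathlib

open scoped UpperHalfPlane ComplexConjugate Manifold Topology

noncomputable section

namespace AnomalousCoeff

/-! ## Vector valued modular forms and mock modular forms of higher depth

Weights are half-integral and are recorded by the integer `k` equal to twice the weight. -/

/-- The matrices `M(T)` and `M(S)` of a multiplier system, for the generators
`T : τ ↦ τ + 1` and `S : τ ↦ -1/τ` of the modular group. -/
structure MultiplierSystem (ι : Type) where
  T : Matrix ι ι ℂ
  S : Matrix ι ι ℂ

/-- `F` (not necessarily holomorphic) transforms as a vector valued modular form of weight `k / 2`
with multiplier system `M`; the power of `τ` is the principal one. -/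
def TransformsModular {ι : Type} [Fintype ι] (k : ℤ) (M : MultiplierSystem ι)
    (F : ι → ℍ → ℂ) : Prop :=
  (∀ i τ, F i (ModularGroup.T • τ) = ∑ j, M.T i j * F j τ) ∧
  (∀ i τ, F i (ModularGroup.S • τ) = (τ : ℂ) ^ ((k : ℂ) / 2) * ∑ j, M.S i j * F j τ)

/-- Holomorphic on the upper half-plane. -/
def Holomorphic (f : ℍ → ℂ) : Prop := MDifferentiable 𝓘(ℂ) 𝓘(ℂ) f

/-- The growth condition of weakly holomorphic forms: `f(τ) = O(|q|^{-N})` as `τ → i∞`,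
for some `N`. -/
def WeaklyBounded (f : ℍ → ℂ) : Prop :=
  ∃ N : ℝ, f =O[UpperHalfPlane.atImInfty] fun τ : ℍ => Real.exp (2 * Real.pi * N * τ.im)

/-- (Weakly) holomorphic vector valued modular forms of weight `k / 2`. -/
def IsModularForm {ι : Type} [Fintype ι] (k : ℤ) (M : MultiplierSystem ι)
    (f : ι → ℍ → ℂ) : Prop :=
  (∀ i, Holomorphic (f i)) ∧ (∀ i, WeaklyBounded (f i)) ∧ TransformsModular k M f

/-- `IsPolarizedCompletion n k M h F`: the holomorphic vector `h` is a mock modular form of depth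
`n`, weight `k / 2` and multiplier system `M`, and `F` is its modular completion, written as a
function of `τ` and of an independent `τ̄`. Namely `F i τ z` is holomorphic in `τ` and
antiholomorphic in `z` (it is the completion with `τ̄` replaced by `z̄`), so that the completion
itself is `τ ↦ F i τ τ`.

Depth `0`: `h` is a holomorphic modular form and `F = h`.
Depth `n + 1`: the completion transforms as a modular form, and there are finitely many
completions `Fs j` of depth `n` (weight `(k + ρ j) / 2`) and holomorphic modular forms `g j`
(weight `2 + ρ j / 2`) with, on the diagonal `z = τ`,
`∂F/∂τ̄ = -2πi ∑ⱼ (4π τ₂) ^ (ρ j / 2) * Fs j * conj (g j)`,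
where vector indices are contracted by equivariant tensors `L j`; off the diagonal `4π τ₂` is
`-2πi (τ - z̄)`. The holomorphic part is `h`, i.e. `F - h` is the corresponding (iterated) Eichler
integral from `z̄` to `-i∞`: it tends to zero as `z → i∞` with `τ` fixed. -/
def IsPolarizedCompletion : ℕ → ∀ {ι : Type} [Fintype ι], ℤ → MultiplierSystem ι →
    (ι → ℍ → ℂ) → (ι → ℍ → ℍ → ℂ) → Prop
  | 0, _, _, k, M, h, F => IsModularForm k M h ∧ ∀ i τ z, F i τ z = h i τ
  | n + 1, ι, _, k, M, h, F =>
    (∀ i, Holomorphic (h i)) ∧ (∀ i, WeaklyBounded (h i)) ∧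
    TransformsModular k M (fun i τ => F i τ τ) ∧
    (∀ i z, Holomorphic (fun τ => F i τ z)) ∧
    (∀ i τ (x : ℝ), Filter.Tendsto
      (fun y : ℝ => F i τ (UpperHalfPlane.ofComplex ((x : ℂ) + y * Complex.I)))
      Filter.atTop (𝓝 (h i τ))) ∧
    ∃ (J : Type) (_ : Fintype J) (α β : J → Type)
      (_ : ∀ j, Fintype (α j)) (_ : ∀ j, Fintype (β j))
      (ρ : J → ℤ) (A : ∀ j, MultiplierSystem (α j)) (B : ∀ j, MultiplierSystem (β j))
      (f : ∀ j, α j → ℍ → ℂ) (Fs : ∀ j, α j → ℍ → ℍ → ℂ) (g : ∀ j, β j → ℍ → ℂ)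
      (L : ∀ j, ι → α j → β j → ℂ),
      (∀ j, IsPolarizedCompletion n (k + ρ j) (A j) (f j) (Fs j)) ∧
      (∀ j, IsModularForm (4 + ρ j) (B j) (g j)) ∧
      (∀ j i a b, ∑ i', M.T i i' * L j i' a b =
        ∑ a', ∑ b', L j i a' b' * (A j).T a' a * conj ((B j).T b' b)) ∧
      (∀ j i a b, ∑ i', M.S i i' * L j i' a b =
        ∑ a', ∑ b', L j i a' b' * (A j).S a' a * conj ((B j).S b' b)) ∧
      (∀ i (τ z : ℍ), HasDerivAt
        (fun w : ℂ => F i τ (UpperHalfPlane.ofComplex (conj w)))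
        (-2 * Real.pi * Complex.I * ∑ j,
          (-2 * Real.pi * Complex.I * ((τ : ℂ) - conj (z : ℂ))) ^ ((ρ j : ℂ) / 2) *
            ∑ a, ∑ b, L j i a b * Fs j a τ z * conj (g j b z))
        (conj (z : ℂ)))

/-- `h` is a mock modular form of depth `n`, weight `k / 2` and multiplier system `M`, with
completion `hHat`. -/
def IsMockModular {ι : Type} [Fintype ι] (n : ℕ) (k : ℤ) (M : MultiplierSystem ι)
    (h hHat : ι → ℍ → ℂ) : Prop :=
  ∃ F : ι → ℍ → ℍ → ℂ, IsPolarizedCompletion n k M h F ∧ ∀ i τ, hHat i τ = F i τ τ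

/-! ## Generalized error functions -/

/-- The generalized error function
`E(𝓜; u) = ∫ exp (-π ∑ᵢ (uᵢ - u'ᵢ)²) ∏ⱼ sgn ((𝓜ᵗʳ u')ⱼ) du'`. -/
def genErr {ι e : Type} [Fintype ι] [Fintype e] (𝓜 : Matrix ι e ℝ) (u : ι → ℝ) : ℝ :=
  ∫ u' : ι → ℝ, Real.exp (-Real.pi * ∑ i, (u i - u' i) ^ 2) *
    ∏ j, Real.sign ((𝓜.transpose.mulVec u') j)

/-- The bilinear form `v · y = ∑ᵢ wᵢ vᵢ yᵢ`. -/
def form {n : ℕ} (w v y : Fin n → ℝ) : ℝ := ∑ i, w i * v i * y i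

/-- Isometry from `ℝⁿ` with the form of positive weights `w` to the standard Euclidean space. -/
def toEuclid {n : ℕ} (w v : Fin n → ℝ) : EuclideanSpace ℝ (Fin n) :=
  WithLp.toLp 2 fun i => Real.sqrt (w i) * v i

/-- The boosted generalized error function `Φᴱ({v_e}; x) = E(𝓑·𝓥; 𝓑·x)`, where the rows of `𝓑`
are an orthonormal basis of the span of the `v_e` (the choice of basis is immaterial). -/
def boostedGenErr {n : ℕ} {e : Type} [Fintype e] (w : Fin n → ℝ) (V : e → Fin n → ℝ)
    (x : Fin n → ℝ) : ℝ :=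
  let W : Submodule ℝ (EuclideanSpace ℝ (Fin n)) :=
    Submodule.span ℝ (Set.range fun j => toEuclid w (V j))
  let 𝓑 := stdOrthonormalBasis ℝ W
  genErr (Matrix.of fun i j => inner ℝ (𝓑 i : EuclideanSpace ℝ (Fin n)) (toEuclid w (V j)))
    (fun i => inner ℝ (𝓑 i : EuclideanSpace ℝ (Fin n)) (toEuclid w x))

/-! ## The kernels: sums over labeled trees and over Schröder trees

A (reduced) charge `γ̂ = (r, q)` is an element of `ℕ × ℤ`; `κ` is the intersection number. -/

/-- The vectors `v_{ij}` with components `v_{ij,k} = δ_{ki} r_j - δ_{kj} r_i`. -/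
def vecV {n : ℕ} (γ : Fin n → ℕ × ℤ) (i j : Fin n) : Fin n → ℝ := fun k =>
  (if k = i then ((γ j).1 : ℝ) else 0) - (if k = j then ((γ i).1 : ℝ) else 0)

open Classical in
/-- The edges of a labeled graph, each oriented from its smaller to its larger end. -/
def edges {n : ℕ} (T : SimpleGraph (Fin n)) : Finset (Fin n × Fin n) :=
  Finset.univ.filter fun e => e.1 < e.2 ∧ T.Adj e.1 e.2

open Classical in
/-- `v_e = ∑_{i ∈ T_e^s} ∑_{j ∈ T_e^t} v_{ij}`, where `T_e^s`, `T_e^t` are the two components,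
containing the source and the target of `e`, of the tree `T` without the edge `e`. -/
def vecEdge {n : ℕ} (γ : Fin n → ℕ × ℤ) (T : SimpleGraph (Fin n)) (e : Fin n × Fin n) :
    Fin n → ℝ :=
  ∑ i ∈ Finset.univ.filter (fun i => (T.deleteEdges {s(e.1, e.2)}).Reachable e.1 i),
    ∑ j ∈ Finset.univ.filter (fun j => (T.deleteEdges {s(e.1, e.2)}).Reachable e.2 j),
      vecV γ i j

/-- The weights `κ rᵢ` of the bilinear form. -/
def formWeights (κ : ℕ) {n : ℕ} (γ : Fin n → ℕ × ℤ) : Fin n → ℝ := fun i => κ * (γ i).1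

/-- `Φᴱ_T(x)`, the generalized error function of the vectors `v_e` of a labeled tree. -/
def treeErr (κ : ℕ) {n : ℕ} (γ : Fin n → ℕ × ℤ) (T : SimpleGraph (Fin n)) (x : Fin n → ℝ) : ℝ :=
  boostedGenErr (formWeights κ γ) (fun e : {e // e ∈ edges T} => vecEdge γ T e) x

/-- The operator `𝓓(v, y) = v · (y + (1 / 2π) ∂ₓ)`. -/
def opD {n : ℕ} (w v y : Fin n → ℝ) (Φ : (Fin n → ℝ) → ℝ) : (Fin n → ℝ) → ℝ := fun x =>
  form w v y * Φ x + 1 / (2 * Real.pi) * lineDeriv ℝ Φ x v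

open Classical in
/-- `Φ_n(x) = (1/n!) ∑_T [∏_e 𝓓(v_{s(e)t(e)}, y)] Φᴱ_T(x)` at `y = x`, the sum being over the
unrooted trees with `n` labeled vertices (the operators commute). -/
def kernelPhi (κ : ℕ) {n : ℕ} (γ : Fin n → ℕ × ℤ) (x : Fin n → ℝ) : ℝ :=
  (1 / (n.factorial : ℝ)) *
    ∑ T ∈ Finset.univ.filter (fun T : SimpleGraph (Fin n) => T.IsTree),
      ((edges T).toList.foldr
        (fun e Φ => opD (formWeights κ γ) (vecV γ e.1 e.2) x Φ) (treeErr κ γ T)) x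

/-- `𝓔_n(γ̂; τ₂) = Φ_n(x) / (√(2 τ₂))^{n-1}` with `xᵢ = √(2 τ₂) qᵢ / (κ rᵢ)`. -/
def kernelE (κ : ℕ) (l : List (ℕ × ℤ)) (t : ℝ) : ℝ :=
  kernelPhi κ l.get
      (fun i => Real.sqrt (2 * t) * ((l.get i).2 : ℝ) / (κ * ((l.get i).1 : ℝ))) /
    Real.sqrt (2 * t) ^ (l.length - 1)

/-- The `τ₂`-independent part of `𝓔_n`, its limit as `τ₂ → ∞` with fixed charges. -/
def kernelE0 (κ : ℕ) (l : List (ℕ × ℤ)) : ℝ :=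
  Filter.limUnder Filter.atTop (kernelE κ l)

/-- The part of `𝓔_n` that vanishes as `τ₂ → ∞`. -/
def kernelEplus (κ : ℕ) (l : List (ℕ × ℤ)) (t : ℝ) : ℝ := kernelE κ l t - kernelE0 κ l

/-- Planar rooted trees with leaves labeled by charges. -/
inductive PlaneTree : Type
  | leaf (γ : ℕ × ℤ) : PlaneTree
  | node (children : List PlaneTree) : PlaneTree

namespace PlaneTree

/-- Every vertex that is not a leaf has at least two children. -/
def IsSchroder : PlaneTree → Prop
  | leaf _ => True
  | node cs => 2 ≤ cs.length ∧ ∀ c ∈ cs, IsSchroder c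

/-- The charges of the leaves, from left to right. -/
def leaves : PlaneTree → List (ℕ × ℤ)
  | leaf γ => [γ]
  | node cs => (cs.map leaves).flatten

/-- The charge of the root: the sum of the charges of its children. -/
def charge : PlaneTree → ℕ × ℤ
  | leaf γ => γ
  | node cs => (cs.map charge).sum

/-- The number of vertices that are not leaves. -/
def numVertices : PlaneTree → ℕ
  | leaf _ => 0
  | node cs => 1 + (cs.map numVertices).sum

/-- The product of `𝓔⁽⁰⁾_v` over all vertices that are not leaves. -/
def prodE0 (κ : ℕ) : PlaneTree → ℝ
  | leaf _ => 1
  | node cs => kernelE0 κ (cs.map charge) * (cs.map (prodE0 κ)).prod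

/-- `𝓔⁽⁺⁾` at the root times the product of `𝓔⁽⁰⁾_v` over all other vertices that are not leaves;
the one-leaf tree has weight `1`. -/
def weight (κ : ℕ) (t : ℝ) : PlaneTree → ℝ
  | leaf _ => 1
  | node cs => kernelEplus κ (cs.map charge) t * (cs.map (prodE0 κ)).prod

end PlaneTree

/-- The kernel `𝓡_n(γ̂; τ₂)`: a sum over Schröder trees with `n` leaves carrying the given
charges. For `n = 1` it equals `1`. -/
def kernelR (κ : ℕ) (l : List (ℕ × ℤ)) (t : ℝ) : ℝ :=
  1 / 2 ^ (l.length - 1) *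
    ∑ᶠ T ∈ {T : PlaneTree | T.IsSchroder ∧ T.leaves = l},
      (-1) ^ (T.numVertices - 1) * T.weight κ t

/-- `Sym {𝓡_n}`: the average over all orderings of the charges. -/
def symKernelR (κ : ℕ) {n : ℕ} (γ : Fin n → ℕ × ℤ) (t : ℝ) : ℝ :=
  (1 / (n.factorial : ℝ)) *
    ∑ σ : Equiv.Perm (Fin n), kernelR κ (List.ofFn fun i => γ (σ i)) t

/-- The quadratic form `Q_n = q² / (κ r) - ∑ᵢ qᵢ² / (κ rᵢ)` with `q = ∑ qᵢ`, `r = ∑ rᵢ`. -/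
def quadQ (κ : ℕ) {n : ℕ} (γ : Fin n → ℕ × ℤ) : ℝ :=
  ((∑ i, (γ i).2 : ℤ) : ℝ) ^ 2 / (κ * ((∑ i, (γ i).1 : ℕ) : ℝ)) -
    ∑ i, ((γ i).2 : ℝ) ^ 2 / (κ * ((γ i).1 : ℝ))

/-- The non-holomorphic theta series `R^{(r₁,…,r_n)}_{μ,(μ₁,…,μ_n)}`: the sum over integers `qᵢ`
with `∑ qᵢ = μ` and `qᵢ ∈ κ rᵢ ℤ + μᵢ`. -/
def thetaR (κ : ℕ) {n : ℕ} (r : Fin n → ℕ) (μ : ℕ) (m : Fin n → ℕ) (τ : ℍ) : ℂ :=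
  ∑' q : {q : Fin n → ℤ // ∑ i, q i = μ ∧ ∀ i, ((κ * r i : ℕ) : ℤ) ∣ q i - m i},
    (symKernelR κ (fun i => (r i, q.1 i)) τ.im : ℂ) *
      Complex.exp (Real.pi * Complex.I * τ * quadQ κ (fun i => (r i, q.1 i)))

/-! ## Generating functions and anomalous coefficients

A residue class modulo `κ r` is given by its representative `μ` in `{0, …, κ r - 1}`. -/

/-- The tuples `(μ₁,…,μ_n)` with `0 ≤ μᵢ < κ rᵢ`. -/
def residues (κ : ℕ) {n : ℕ} (r : Fin n → ℕ) : Finset (Fin n → ℕ) :=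
  Fintype.piFinset fun i => Finset.range (κ * r i)

/-- The sum `∑_n ∑_{r₁+⋯+r_n = r} ∑_μ C^{(r₁,…,r_n)}_{μ,(μ₁,…,μ_n)} ∏ᵢ h_{rᵢ,μᵢ}`
over the ordered decompositions of `r` into positive integers. -/
def chargeSum (κ : ℕ) (C : ∀ n : ℕ, (Fin n → ℕ) → ℕ → (Fin n → ℕ) → ℍ → ℂ)
    (h : ℕ → ℕ → ℍ → ℂ) (r μ : ℕ) (τ : ℍ) : ℂ :=
  ∑ c : Composition r, ∑ m ∈ residues κ c.blocksFun,
    C c.length c.blocksFun μ m τ * ∏ i, h (c.blocksFun i) (m i) τ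

/-- The right-hand side of the completion equation of the generating functions `h_{r,μ}`. -/
def completionH (κ : ℕ) (h : ℕ → ℕ → ℍ → ℂ) (r μ : ℕ) (τ : ℍ) : ℂ :=
  chargeSum κ (fun _ r μ m τ => thetaR κ r μ m τ) h r μ τ

/-- The expression `∑_m ∑_{n₁+⋯+n_m = n} ∑_ν R^{(s)}_{μ,ν} ∏ₖ g^{(𝔯ₖ)}_{νₖ,𝔪ₖ}`, where `𝔯ₖ`, `𝔪ₖ` are
the consecutive blocks of lengths `nₖ` of `r` and `m`, and `sₖ` is the sum of the entries of `𝔯ₖ`. -/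
def completionGUnsym (κ : ℕ) (g : ∀ n : ℕ, (Fin n → ℕ) → ℕ → (Fin n → ℕ) → ℍ → ℂ)
    {n : ℕ} (r : Fin n → ℕ) (μ : ℕ) (m : Fin n → ℕ) (τ : ℍ) : ℂ :=
  ∑ d : Composition n, ∑ ν ∈ residues κ (fun k => ∑ i, r (d.embedding k i)),
    thetaR κ (fun k => ∑ i, r (d.embedding k i)) μ ν τ *
      ∏ k, g (d.blocksFun k) (fun i => r (d.embedding k i)) (ν k)
        (fun i => m (d.embedding k i)) τ

/-- The right-hand side of the completion equation of the anomalous coefficients: the average of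
the previous expression over all simultaneous permutations of the `(rᵢ, μᵢ)`. -/
def completionG (κ : ℕ) (g : ∀ n : ℕ, (Fin n → ℕ) → ℕ → (Fin n → ℕ) → ℍ → ℂ)
    {n : ℕ} (r : Fin n → ℕ) (μ : ℕ) (m : Fin n → ℕ) (τ : ℍ) : ℂ :=
  (1 / (n.factorial : ℂ)) * ∑ σ : Equiv.Perm (Fin n),
    completionGUnsym κ g (fun i => r (σ i)) μ (fun i => m (σ i)) τ

/-- The multiplier system of the generating functions `h_{r,μ}`. -/
def multH (κ : ℕ) (c₂ : ℤ) (r : ℕ) : MultiplierSystem (Fin (κ * r)) where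
  T := Matrix.of fun μ ν => if μ = ν then
    Complex.exp (Real.pi * Complex.I / (κ * r) * (1 - κ * r) * (μ : ℕ) ^ 2 +
      Real.pi * Complex.I / 4 * (κ + c₂ / 3) * r) else 0
  S := Matrix.of fun μ ν =>
    Complex.exp (Real.pi * Complex.I / 4 * ((2 * κ + c₂) * r - 1)) / Real.sqrt (κ * r) *
      Complex.exp (-2 * Real.pi * Complex.I * ((μ : ℕ) * (ν : ℕ) / (κ * r)))

/-- The index set of the components `g_{μ,(μ₁,…,μ_n)}`. -/
abbrev GIndex (κ : ℕ) {n : ℕ} (r : Fin n → ℕ) : Type :=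
  Fin (κ * ∑ i, r i) × (∀ i, Fin (κ * r i))

/-- The multiplier system of the anomalous coefficients `g^{(r₁,…,r_n)}`. -/
def multG (κ : ℕ) {n : ℕ} (r : Fin n → ℕ) : MultiplierSystem (GIndex κ r) where
  T := Matrix.of fun p p' => if p = p' then
    Complex.exp (Real.pi * Complex.I * ((p.1 : ℕ) - ∑ i, ((p.2 i : ℕ) : ℂ)) +
      Real.pi * Complex.I * ((p.1 : ℕ) ^ 2 / (κ * (∑ i, r i : ℕ)) -
        ∑ i, ((p.2 i : ℕ) : ℂ) ^ 2 / (κ * r i))) else 0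
  S := Matrix.of fun p p' =>
    Complex.exp (Real.pi * Complex.I / 4 * (n - 1)) /
        Real.sqrt (κ ^ (n + 1) * (∑ i, r i : ℕ) * ∏ i, (r i : ℝ)) *
      Complex.exp (-2 * Real.pi * Complex.I *
        ((p.1 : ℕ) * (p'.1 : ℕ) / (κ * (∑ i, r i : ℕ)) -
          ∑ i, ((p.2 i : ℕ) : ℂ) * (p'.2 i : ℕ) / (κ * r i)))

end AnomalousCoeff

end

open AnomalousCoeff

namespace AnomalousCoeff

/-! ### Holomorphic and weakly bounded functions -/

/-! The argument splits into a formal part about mock modular forms and a combinatorial part about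
the completion.

Formally, polarized completions of a given depth are stable under raising the depth, contraction
with an equivariant matrix, tensoring with a holomorphic modular form, and finite sums. One ordered
decomposition of `r` into `n` parts contributes the contraction of `g` with `n` forms of weight
-3/2. It therefore has weight 3(n-1)/2 - 3n/2 = -3/2 and depth n - 1 ≤ r - 1, with completion given
by replacing `g` by its completion. The contraction is equivariant (`multH_intertwines`): for T by a
parity computation, for S by orthogonality of the characters of the finite residue groups.

It remains to identify the resulting sum of completed coefficients with the prescribed right-hand
side (`completionH_chargeSum_eq_sum_completionG`). Inserting the definition of the generating
functions into the latter gives a sum over compositions of `r` with every block decomposed further.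
Inserting the completion of `g` gives a sum over fine compositions of `r` together with a grouping
of their parts. These describe the same two-level decompositions, via
`Composition.sigmaEquivSigmaPi`, and the symmetrization disappears because all ordered
decompositions are summed. The theta series stays an opaque coefficient throughout. -/

theorem holomorphic_iff {f : ℍ → ℂ} :
    Holomorphic f ↔ DifferentiableOn ℂ (f ∘ UpperHalfPlane.ofComplex) {z | 0 < z.im} :=
  UpperHalfPlane.mdifferentiable_iff

theorem Holomorphic.mul {f g : ℍ → ℂ} (hf : Holomorphic f) (hg : Holomorphic g) :
    Holomorphic fun τ => f τ * g τ := by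
  rw [holomorphic_iff] at *
  exact DifferentiableOn.fun_mul hf hg

theorem holomorphic_const (c : ℂ) : Holomorphic fun _ => c := by
  rw [holomorphic_iff]
  exact differentiableOn_const c

theorem Holomorphic.const_mul {f : ℍ → ℂ} (hf : Holomorphic f) (c : ℂ) :
    Holomorphic fun τ => c * f τ :=
  (holomorphic_const c).mul hf

theorem Holomorphic.sum {α : Type*} {s : Finset α} {f : α → ℍ → ℂ}
    (hf : ∀ a ∈ s, Holomorphic (f a)) : Holomorphic fun τ => ∑ a ∈ s, f a τ := by
  simp only [holomorphic_iff] at *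
  exact DifferentiableOn.fun_sum hf

theorem Holomorphic.prod {α : Type*} {s : Finset α} {f : α → ℍ → ℂ}
    (hf : ∀ a ∈ s, Holomorphic (f a)) : Holomorphic fun τ => ∏ a ∈ s, f a τ := by
  classical
  induction s using Finset.induction_on with
  | empty => simpa using holomorphic_const 1
  | insert a s ha ih =>
    simp only [Finset.prod_insert ha]
    exact (hf a (Finset.mem_insert_self a s)).mul
      (ih fun b hb => hf b (Finset.mem_insert_of_mem hb))

theorem weaklyBounded_const (c : ℂ) : WeaklyBounded fun _ => c :=
  ⟨0, by simpa using Asymptotics.isBigO_const_const c (one_ne_zero : (1 : ℝ) ≠ 0) _⟩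

theorem WeaklyBounded.mul {f g : ℍ → ℂ} (hf : WeaklyBounded f) (hg : WeaklyBounded g) :
    WeaklyBounded fun τ => f τ * g τ := by
  obtain ⟨N, hN⟩ := hf
  obtain ⟨K, hK⟩ := hg
  refine ⟨N + K, (hN.mul hK).congr_right fun τ => ?_⟩
  rw [← Real.exp_add]
  ring_nf

theorem WeaklyBounded.const_mul {f : ℍ → ℂ} (hf : WeaklyBounded f) (c : ℂ) :
    WeaklyBounded fun τ => c * f τ :=
  (weaklyBounded_const c).mul hf

theorem WeaklyBounded.add {f g : ℍ → ℂ} (hf : WeaklyBounded f) (hg : WeaklyBounded g) :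
    WeaklyBounded fun τ => f τ + g τ := by
  obtain ⟨N, hN⟩ := hf
  obtain ⟨K, hK⟩ := hg
  have key : ∀ {A B : ℝ}, A ≤ B → (fun τ : ℍ => Real.exp (2 * Real.pi * A * τ.im))
      =O[UpperHalfPlane.atImInfty] fun τ : ℍ => Real.exp (2 * Real.pi * B * τ.im) := by
    intro A B h
    refine Asymptotics.IsBigO.of_norm_le fun τ => ?_
    rw [Real.norm_eq_abs, Real.abs_exp]
    have := τ.im_pos
    gcongr
  exact ⟨max N K, (hN.trans (key (le_max_left _ _))).add (hK.trans (key (le_max_right _ _)))⟩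

theorem WeaklyBounded.sum {α : Type*} {s : Finset α} {f : α → ℍ → ℂ}
    (hf : ∀ a ∈ s, WeaklyBounded (f a)) : WeaklyBounded fun τ => ∑ a ∈ s, f a τ := by
  classical
  induction s using Finset.induction_on with
  | empty => simpa using weaklyBounded_const 0
  | insert a s ha ih =>
    simp only [Finset.sum_insert ha]
    exact (hf a (Finset.mem_insert_self a s)).add
      (ih fun b hb => hf b (Finset.mem_insert_of_mem hb))

theorem WeaklyBounded.prod {α : Type*} {s : Finset α} {f : α → ℍ → ℂ}
    (hf : ∀ a ∈ s, WeaklyBounded (f a)) : WeaklyBounded fun τ => ∏ a ∈ s, f a τ := by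
  classical
  induction s using Finset.induction_on with
  | empty => simpa using weaklyBounded_const 1
  | insert a s ha ih =>
    simp only [Finset.prod_insert ha]
    exact (hf a (Finset.mem_insert_self a s)).mul
      (ih fun b hb => hf b (Finset.mem_insert_of_mem hb))

/-! ### Operations on multiplier systems -/

/-- The tensor product of two multiplier systems. -/
def MultiplierSystem.tensor {ι ι' : Type} (M : MultiplierSystem ι) (N : MultiplierSystem ι') :
    MultiplierSystem (ι × ι') where
  T := Matrix.of fun p q => M.T p.1 q.1 * N.T p.2 q.2
  S := Matrix.of fun p q => M.S p.1 q.1 * N.S p.2 q.2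

/-- The tensor product of a finite family of multiplier systems. -/
def MultiplierSystem.pi {n : ℕ} {ι : Fin n → Type} (M : ∀ i, MultiplierSystem (ι i)) :
    MultiplierSystem (∀ i, ι i) where
  T := Matrix.of fun p q => ∏ i, (M i).T (p i) (q i)
  S := Matrix.of fun p q => ∏ i, (M i).S (p i) (q i)

/-- The matrix `C` intertwines the multiplier systems `M` and `N`: `M C = C N`. -/
def MultiplierSystem.Intertwines {ι ι' : Type} [Fintype ι] [Fintype ι']
    (M : MultiplierSystem ι) (N : MultiplierSystem ι') (C : ι → ι' → ℂ) : Prop :=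
  (∀ i a, ∑ i', M.T i i' * C i' a = ∑ a', C i a' * N.T a' a) ∧
  (∀ i a, ∑ i', M.S i i' * C i' a = ∑ a', C i a' * N.S a' a)

/-- Associativity in matrix form: C(Bv) = (CB)v = (AC)v = A(Cv). -/
theorem sum_mul_sum_of_intertwine {ι ι' : Type} [Fintype ι] [Fintype ι']
    {A : ι → ι → ℂ} {B : ι' → ι' → ℂ} {C : ι → ι' → ℂ}
    (h : ∀ i a, ∑ i', A i i' * C i' a = ∑ a', C i a' * B a' a) (v : ι' → ℂ) (i : ι) :
    ∑ a, C i a * ∑ a', B a a' * v a' = ∑ i', A i i' * ∑ a, C i' a * v a := by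
  simp only [Finset.mul_sum, ← mul_assoc]
  rw [Finset.sum_comm, Finset.sum_comm (s := (Finset.univ : Finset ι))]
  simp only [← Finset.sum_mul, h]

/-! ### Vector valued transformations -/

theorem TransformsModular.tensor {ι ι' : Type} [Fintype ι] [Fintype ι'] {k l : ℤ}
    {M : MultiplierSystem ι} {N : MultiplierSystem ι'} {F : ι → ℍ → ℂ} {H : ι' → ℍ → ℂ}
    (hF : TransformsModular k M F) (hH : TransformsModular l N H) :
    TransformsModular (k + l) (M.tensor N) fun p τ => F p.1 τ * H p.2 τ := by
  refine ⟨fun p τ => ?_, fun p τ => ?_⟩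
  · beta_reduce
    rw [hF.1, hH.1, Finset.sum_mul_sum, Fintype.sum_prod_type]
    refine Finset.sum_congr rfl fun i _ => Finset.sum_congr rfl fun j _ => ?_
    simp only [MultiplierSystem.tensor, Matrix.of_apply]
    ring
  -- Principal powers of one fixed nonzero base add in the exponent, so half-integral weights cause
  -- no branch ambiguity.
  · have h : (τ : ℂ) ^ (((k + l : ℤ) : ℂ) / 2) =
        (τ : ℂ) ^ ((k : ℂ) / 2) * (τ : ℂ) ^ ((l : ℂ) / 2) := by
      rw [← Complex.cpow_add _ _ (UpperHalfPlane.ne_zero τ)]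
      push_cast
      ring_nf
    beta_reduce
    rw [hF.2, hH.2, h, mul_mul_mul_comm, Finset.sum_mul_sum, Fintype.sum_prod_type]
    congr 1
    refine Finset.sum_congr rfl fun i _ => Finset.sum_congr rfl fun j _ => ?_
    simp only [MultiplierSystem.tensor, Matrix.of_apply]
    ring

theorem TransformsModular.pi {n : ℕ} {ι : Fin n → Type} [∀ i, Fintype (ι i)] {k : ℤ}
    {M : ∀ i, MultiplierSystem (ι i)} {F : ∀ i, ι i → ℍ → ℂ}
    (hF : ∀ i, TransformsModular k (M i) (F i)) :
    TransformsModular (n * k) (MultiplierSystem.pi M) fun p τ => ∏ i, F i (p i) τ := by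
  refine ⟨fun p τ => ?_, fun p τ => ?_⟩
  · simp only [(hF _).1, MultiplierSystem.pi, Matrix.of_apply, Fintype.prod_sum,
      Finset.prod_mul_distrib]
  · have h : (τ : ℂ) ^ (((n * k : ℤ) : ℂ) / 2) = ((τ : ℂ) ^ ((k : ℂ) / 2)) ^ n := by
      rw [← Complex.cpow_nat_mul]
      push_cast
      ring_nf
    rw [h]
    simp only [(hF _).2, MultiplierSystem.pi, Matrix.of_apply, Finset.prod_mul_distrib,
      Fintype.prod_sum]
    simp

theorem TransformsModular.contract {ι ι' : Type} [Fintype ι] [Fintype ι'] {k : ℤ}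
    {M : MultiplierSystem ι} {N : MultiplierSystem ι'} {F : ι' → ℍ → ℂ} {C : ι → ι' → ℂ}
    (hC : M.Intertwines N C) (hF : TransformsModular k N F) :
    TransformsModular k M fun i τ => ∑ a, C i a * F a τ := by
  refine ⟨fun i τ => ?_, fun i τ => ?_⟩
  · simp only [hF.1]
    exact sum_mul_sum_of_intertwine hC.1 _ i
  · simp only [hF.2, mul_left_comm (C i _), ← Finset.mul_sum]
    congr 1
    exact sum_mul_sum_of_intertwine hC.2 _ i

theorem TransformsModular.sum {ι α : Type} [Fintype ι] {k : ℤ} {M : MultiplierSystem ι}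
    {s : Finset α} {F : α → ι → ℍ → ℂ} (hF : ∀ a ∈ s, TransformsModular k M (F a)) :
    TransformsModular k M fun i τ => ∑ a ∈ s, F a i τ := by
  refine ⟨fun i τ => ?_, fun i τ => ?_⟩
  · beta_reduce
    rw [Finset.sum_congr rfl fun a ha => (hF a ha).1 i τ, Finset.sum_comm]
    simp only [Finset.mul_sum]
  · beta_reduce
    rw [Finset.sum_congr rfl fun a ha => (hF a ha).2 i τ, ← Finset.mul_sum, Finset.sum_comm]
    simp only [Finset.mul_sum]

/-! ### Holomorphic modular forms -/

theorem IsModularForm.tensor {ι ι' : Type} [Fintype ι] [Fintype ι'] {k l : ℤ}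
    {M : MultiplierSystem ι} {N : MultiplierSystem ι'} {f : ι → ℍ → ℂ} {g : ι' → ℍ → ℂ}
    (hf : IsModularForm k M f) (hg : IsModularForm l N g) :
    IsModularForm (k + l) (M.tensor N) fun p τ => f p.1 τ * g p.2 τ :=
  ⟨fun p => (hf.1 p.1).mul (hg.1 p.2), fun p => (hf.2.1 p.1).mul (hg.2.1 p.2),
    hf.2.2.tensor hg.2.2⟩

theorem IsModularForm.pi {n : ℕ} {ι : Fin n → Type} [∀ i, Fintype (ι i)] {k : ℤ}
    {M : ∀ i, MultiplierSystem (ι i)} {f : ∀ i, ι i → ℍ → ℂ}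
    (hf : ∀ i, IsModularForm k (M i) (f i)) :
    IsModularForm (n * k) (MultiplierSystem.pi M) fun p τ => ∏ i, f i (p i) τ :=
  ⟨fun p => Holomorphic.prod fun i _ => (hf i).1 (p i),
    fun p => WeaklyBounded.prod fun i _ => (hf i).2.1 (p i),
    TransformsModular.pi fun i => (hf i).2.2⟩

theorem IsModularForm.contract {ι ι' : Type} [Fintype ι] [Fintype ι'] {k : ℤ}
    {M : MultiplierSystem ι} {N : MultiplierSystem ι'} {f : ι' → ℍ → ℂ} {C : ι → ι' → ℂ}
    (hC : M.Intertwines N C) (hf : IsModularForm k N f) :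
    IsModularForm k M fun i τ => ∑ a, C i a * f a τ :=
  ⟨fun i => Holomorphic.sum fun a _ => (hf.1 a).const_mul (C i a),
    fun i => WeaklyBounded.sum fun a _ => (hf.2.1 a).const_mul (C i a), hf.2.2.contract hC⟩

theorem IsModularForm.sum {ι α : Type} [Fintype ι] {k : ℤ} {M : MultiplierSystem ι}
    {s : Finset α} {f : α → ι → ℍ → ℂ} (hf : ∀ a ∈ s, IsModularForm k M (f a)) :
    IsModularForm k M fun i τ => ∑ a ∈ s, f a i τ :=
  ⟨fun i => Holomorphic.sum fun a ha => (hf a ha).1 i,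
    fun i => WeaklyBounded.sum fun a ha => (hf a ha).2.1 i,
    TransformsModular.sum fun a ha => (hf a ha).2.2⟩

/-! ### Closure properties of completions -/

/-- The depth may be raised by one. -/
theorem IsPolarizedCompletion.succ {n : ℕ} {ι : Type} [Fintype ι] {k : ℤ}
    {M : MultiplierSystem ι} {h : ι → ℍ → ℂ} {F : ι → ℍ → ℍ → ℂ}
    (hF : IsPolarizedCompletion n k M h F) : IsPolarizedCompletion (n + 1) k M h F := by
  induction n generalizing ι k with
  | zero =>
    obtain ⟨⟨h1, h2, h3⟩, h4⟩ := hF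
    obtain rfl : F = fun i τ _ => h i τ := by
      funext i τ z
      exact h4 i τ z
    -- In depth zero `F` is constant in its second variable, so the derivative condition holds with
    -- an empty family of shadow data.
    refine ⟨h1, h2, h3, fun i z => h1 i, fun i τ x => tendsto_const_nhds, Empty, inferInstance,
      fun _ => Empty, fun _ => Empty, fun _ => inferInstance, fun _ => inferInstance,
      fun _ => 0, Empty.rec, Empty.rec, Empty.rec, Empty.rec, Empty.rec, Empty.rec,
      fun j => j.elim, fun j => j.elim, fun j => j.elim, fun j => j.elim, fun i τ z => ?_⟩
    simpa using hasDerivAt_const (conj (z : ℂ)) (h i τ)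
  | succ n ih =>
    obtain ⟨h1, h2, h3, h4, h5, J, iJ, α, β, iα, iβ, ρ, A, B, f, Fs, g, L, h6, h7⟩ := hF
    exact ⟨h1, h2, h3, h4, h5, J, iJ, α, β, iα, iβ, ρ, A, B, f, Fs, g, L,
      fun j => ih (h6 j), h7⟩

theorem IsPolarizedCompletion.mono {n m : ℕ} (hnm : n ≤ m) {ι : Type} [Fintype ι] {k : ℤ}
    {M : MultiplierSystem ι} {h : ι → ℍ → ℂ} {F : ι → ℍ → ℍ → ℂ}
    (hF : IsPolarizedCompletion n k M h F) : IsPolarizedCompletion m k M h F := by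
  induction hnm with
  | refl => exact hF
  | step _ ih => exact ih.succ

/-- Contraction with an equivariant matrix. -/
theorem IsPolarizedCompletion.contract {n : ℕ} {ι ι' : Type} [Fintype ι] [Fintype ι'] {k : ℤ}
    {M : MultiplierSystem ι} {N : MultiplierSystem ι'} {h : ι' → ℍ → ℂ} {F : ι' → ℍ → ℍ → ℂ}
    {C : ι → ι' → ℂ} (hC : M.Intertwines N C) (hF : IsPolarizedCompletion n k N h F) :
    IsPolarizedCompletion n k M (fun i τ => ∑ p, C i p * h p τ)
      (fun i τ z => ∑ p, C i p * F p τ z) := by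
  cases n with
  | zero => exact ⟨hF.1.contract hC, fun i τ z => by simp only [hF.2]⟩
  | succ n =>
    obtain ⟨h1, h2, h3, h4, h5, J, iJ, α, β, iα, iβ, ρ, A, B, f, Fs, g, L, h6, h7, h8, h9, h10⟩ :=
      hF
    -- The new shadow tensor is the product of `C` with `L`; the lower-depth completions and the
    -- shadows are unchanged, so no induction on the depth is needed.
    have equivariant : ∀ {P : ι → ι → ℂ} {Q : ι' → ι' → ℂ},
        (∀ i a, ∑ i', P i i' * C i' a = ∑ a', C i a' * Q a' a) → ∀ {j} (X : ι' → ℂ) a b,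
        (∀ p, ∑ q, Q p q * L j q a b = X p) → ∀ i,
        ∑ i', P i i' * ∑ p, C i' p * L j p a b = ∑ p, C i p * X p := by
      intro P Q hPQ j X a b hX i
      rw [← sum_mul_sum_of_intertwine hPQ (fun p => L j p a b) i]
      simp only [hX]
    refine ⟨fun i => Holomorphic.sum fun p _ => (h1 p).const_mul _,
      fun i => WeaklyBounded.sum fun p _ => (h2 p).const_mul _, h3.contract hC,
      fun i z => Holomorphic.sum fun p _ => (h4 p z).const_mul _,
      fun i τ x => tendsto_finsetSum _ fun p _ => (h5 p τ x).const_mul _,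
      J, iJ, α, β, iα, iβ, ρ, A, B, f, Fs, g, fun j i a b => ∑ p, C i p * L j p a b, h6, h7,
      fun j i a b => ?_, fun j i a b => ?_, fun i τ z => ?_⟩
    · rw [equivariant hC.1 _ a b (fun p => h8 j p a b) i]
      simp only [Finset.mul_sum, Finset.sum_mul]
      rw [Finset.sum_comm]
      refine Finset.sum_congr rfl fun a' _ => ?_
      rw [Finset.sum_comm]
      simp only [mul_assoc]
    · rw [equivariant hC.2 _ a b (fun p => h9 j p a b) i]
      simp only [Finset.mul_sum, Finset.sum_mul]
      rw [Finset.sum_comm]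
      refine Finset.sum_congr rfl fun a' _ => ?_
      rw [Finset.sum_comm]
      simp only [mul_assoc]
    · refine (HasDerivAt.fun_sum fun p _ => (h10 p τ z).const_mul (C i p)).congr_deriv ?_
      simp only [mul_left_comm (C i _), ← Finset.mul_sum]
      congr 1
      simp only [Finset.mul_sum, Finset.sum_mul]
      rw [Finset.sum_comm]
      refine Finset.sum_congr rfl fun j _ => ?_
      rw [Finset.sum_comm]
      refine Finset.sum_congr rfl fun a _ => ?_
      rw [Finset.sum_comm]
      refine Finset.sum_congr rfl fun b _ => Finset.sum_congr rfl fun p _ => ?_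
      ring

/-- Multiplication by a holomorphic modular form. -/
theorem IsPolarizedCompletion.tensor {n : ℕ} {ι ι' : Type} [Fintype ι] [Fintype ι'] {k l : ℤ}
    {M : MultiplierSystem ι} {N : MultiplierSystem ι'} {h : ι → ℍ → ℂ} {F : ι → ℍ → ℍ → ℂ}
    {H : ι' → ℍ → ℂ} (hF : IsPolarizedCompletion n k M h F) (hH : IsModularForm l N H) :
    IsPolarizedCompletion n (k + l) (M.tensor N) (fun p τ => h p.1 τ * H p.2 τ)
      (fun p τ z => F p.1 τ z * H p.2 τ) := by
  classical
  induction n generalizing ι k with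
  | zero => exact ⟨hF.1.tensor hH, fun p τ z => by simp only [hF.2]⟩
  | succ n ih =>
    obtain ⟨h1, h2, h3, h4, h5, J, iJ, α, β, iα, iβ, ρ, A, B, f, Fs, g, L, h6, h7, h8, h9, h10⟩ :=
      hF
    -- `H` is independent of the second variable, so differentiation only replaces each `Fs j` by
    -- its product with `H`. The new tensor is `L j` times the identity on `ι'`, which commutes with
    -- any `R`.
    have equivariant : ∀ {P : ι → ι → ℂ} {R : ι' → ι' → ℂ} {j}
        {Q : α j → α j → ℂ} {S : β j → β j → ℂ},
        (∀ i a b, ∑ i', P i i' * L j i' a b = ∑ a', ∑ b', L j i a' b' * Q a' a * conj (S b' b)) →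
        ∀ (i : ι × ι') (a : α j × ι') b,
        ∑ i' : ι × ι', P i.1 i'.1 * R i.2 i'.2 * (if i'.2 = a.2 then L j i'.1 a.1 b else 0) =
        ∑ a' : α j × ι', ∑ b', (if i.2 = a'.2 then L j i.1 a'.1 b' else 0) *
          (Q a'.1 a.1 * R a'.2 a.2) * conj (S b' b) := by
      intro P R j Q S hPQ i a b
      simp only [Fintype.sum_prod_type, mul_ite, ite_mul, mul_zero, zero_mul, Finset.sum_ite_eq',
        Finset.mem_univ, if_true]
      simp only [mul_right_comm _ (R _ _), ← Finset.sum_mul, hPQ]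
      simp only [Finset.sum_mul]
      refine Finset.sum_congr rfl fun a' _ => ?_
      rw [Finset.sum_comm]
      refine Finset.sum_congr rfl fun b' _ => ?_
      simp only [Finset.sum_ite_eq, Finset.mem_univ, if_true]
      ring
    refine ⟨fun p => (h1 p.1).mul (hH.1 p.2), fun p => (h2 p.1).mul (hH.2.1 p.2),
      h3.tensor hH.2.2, fun p z => (h4 p.1 z).mul (hH.1 p.2),
      fun p τ x => (h5 p.1 τ x).mul_const _,
      J, iJ, fun j => α j × ι', β, fun j => inferInstance, iβ, ρ, fun j => (A j).tensor N, B,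
      fun j p τ => f j p.1 τ * H p.2 τ, fun j p τ z => Fs j p.1 τ z * H p.2 τ, g,
      fun j p a b => if p.2 = a.2 then L j p.1 a.1 b else 0, fun j => ?_, h7,
      fun j => equivariant (h8 j), fun j => equivariant (h9 j), fun p τ z => ?_⟩
    · rw [add_right_comm]
      exact ih (h6 j)
    · refine ((h10 p.1 τ z).mul_const (H p.2 τ)).congr_deriv ?_
      rw [mul_assoc, Finset.sum_mul]
      congr 1
      refine Finset.sum_congr rfl fun j _ => ?_
      rw [mul_assoc, Fintype.sum_prod_type, Finset.sum_mul]
      congr 1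
      refine Finset.sum_congr rfl fun a _ => ?_
      rw [Finset.sum_comm, Finset.sum_mul]
      refine Finset.sum_congr rfl fun b _ => ?_
      simp only [ite_mul, zero_mul, Finset.sum_ite_eq, Finset.mem_univ, if_true]
      ring

/-- Finite sums. -/
theorem IsPolarizedCompletion.sum {n : ℕ} {ι α : Type} [Fintype ι] [Fintype α] {k : ℤ}
    {M : MultiplierSystem ι} {h : α → ι → ℍ → ℂ} {F : α → ι → ℍ → ℍ → ℂ}
    (hF : ∀ c, IsPolarizedCompletion n k M (h c) (F c)) :
    IsPolarizedCompletion n k M (fun i τ => ∑ c, h c i τ) (fun i τ z => ∑ c, F c i τ z) := by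
  cases n with
  | zero =>
    exact ⟨IsModularForm.sum fun c _ => (hF c).1, fun i τ z => by simp only [(hF _).2]⟩
  | succ n =>
    -- Each summand brings its own shadow data; those of the sum are indexed by the disjoint union
    -- of the families `J c`.
    choose h1 h2 h3 h4 h5 J iJ a b ia ib ρ A B f Fs g L h6 h7 h8 h9 h10 using hF
    refine ⟨fun i => Holomorphic.sum fun c _ => h1 c i,
      fun i => WeaklyBounded.sum fun c _ => h2 c i, TransformsModular.sum fun c _ => h3 c,
      fun i z => Holomorphic.sum fun c _ => h4 c i z,
      fun i τ x => tendsto_finsetSum _ fun c _ => h5 c i τ x,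
      (Σ c, J c), inferInstance, fun j => a j.1 j.2, fun j => b j.1 j.2, fun j => ia j.1 j.2,
      fun j => ib j.1 j.2, fun j => ρ j.1 j.2, fun j => A j.1 j.2, fun j => B j.1 j.2,
      fun j => f j.1 j.2, fun j => Fs j.1 j.2, fun j => g j.1 j.2, fun j => L j.1 j.2,
      fun j => h6 j.1 j.2, fun j => h7 j.1 j.2, fun j => h8 j.1 j.2, fun j => h9 j.1 j.2,
      fun i τ z => ?_⟩
    refine (HasDerivAt.fun_sum fun c _ => h10 c i τ z).congr_deriv ?_
    rw [← Finset.mul_sum, Fintype.sum_sigma]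

/-! ### The multiplier systems of the generating functions and of the anomalous coefficients -/

/-- Passes from residues given as natural numbers to the `Fin`-valued indices of the multiplier
systems. -/
theorem sum_residues {X : Type*} [AddCommMonoid X] (κ : ℕ) {n : ℕ} (s : Fin n → ℕ)
    (φ : (Fin n → ℕ) → X) :
    ∑ m ∈ residues κ s, φ m = ∑ m : ∀ i, Fin (κ * s i), φ fun i => m i := by
  symm
  refine Finset.sum_bij (fun m _ i => (m i : ℕ)) (fun m _ => ?_) (fun m _ m' _ h => ?_)
    (fun m hm => ?_) fun _ _ => rfl
  · simp [residues]
  · funext i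
    exact Fin.ext (congrFun h i)
  · simp only [residues, Fintype.mem_piFinset, Finset.mem_range] at hm
    exact ⟨fun i => ⟨m i, hm i⟩, Finset.mem_univ _, rfl⟩

/-- Orthogonality of the additive characters of `ℤ / N`. -/
theorem sum_exp_mul_exp_neg {N : ℕ} (a b : Fin N) :
    ∑ x : Fin N, Complex.exp (2 * Real.pi * Complex.I * ((x : ℕ) * (a : ℕ) / N)) *
      Complex.exp (-2 * Real.pi * Complex.I * ((x : ℕ) * (b : ℕ) / N)) =
    if a = b then (N : ℂ) else 0 := by
  have hN : (N : ℂ) ≠ 0 := by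
    have := a.pos
    exact_mod_cast this.ne'
  set ζ := Complex.exp (2 * Real.pi * Complex.I * (((a : ℕ) - (b : ℕ) : ℂ) / N)) with hζ
  have hterm : ∀ x : Fin N, Complex.exp (2 * Real.pi * Complex.I * ((x : ℕ) * (a : ℕ) / N)) *
      Complex.exp (-2 * Real.pi * Complex.I * ((x : ℕ) * (b : ℕ) / N)) = ζ ^ (x : ℕ) := by
    intro x
    rw [hζ, ← Complex.exp_nat_mul, ← Complex.exp_add]
    ring_nf
  simp only [hterm]
  rw [Fin.sum_univ_eq_sum_range (fun i => ζ ^ i)]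
  split_ifs with hab
  · subst hab
    simp [hζ]
  · have hpow : ζ ^ N = 1 := by
      rw [hζ, ← Complex.exp_nat_mul, Complex.exp_eq_one_iff]
      exact ⟨(a : ℕ) - (b : ℕ), by push_cast; field_simp⟩
    have hne : ζ ≠ 1 := by
      intro h
      rw [hζ, Complex.exp_eq_one_iff] at h
      obtain ⟨k, hk⟩ := h
      rw [mul_comm (k : ℂ)] at hk
      have hk' := mul_left_cancel₀ Complex.two_pi_I_ne_zero hk
      rw [div_eq_iff hN] at hk'
      -- If ζ were 1, `N` would divide a - b, whose absolute value is less than `N`.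
      have hz : ((a : ℕ) : ℤ) - (b : ℕ) = k * N := by exact_mod_cast hk'
      have h0 : ((a : ℕ) : ℤ) - (b : ℕ) = 0 := by
        refine Int.eq_zero_of_abs_lt_dvd (m := N) ⟨k, by rw [hz, mul_comm]⟩ ?_
        have := a.2
        have := b.2
        rw [abs_lt]
        constructor <;> omega
      exact hab (Fin.ext (by omega))
    rw [geom_sum_eq hne, hpow]
    simp

/-- The tensor that contracts the anomalous coefficients with the depth zero generating
functions. -/
def contractionTensor (κ : ℕ) {n : ℕ} (s : Fin n → ℕ) (μ : Fin (κ * ∑ i, s i))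
    (p : GIndex κ s × (∀ i, Fin (κ * s i))) : ℂ :=
  if p.1 = (μ, p.2) then 1 else 0

theorem sum_contractionTensor_mul (κ : ℕ) {n : ℕ} (s : Fin n → ℕ) (μ : Fin (κ * ∑ i, s i))
    (φ : GIndex κ s × (∀ i, Fin (κ * s i)) → ℂ) :
    ∑ p, contractionTensor κ s μ p * φ p = ∑ m, φ ((μ, m), m) := by
  rw [Fintype.sum_prod_type, Finset.sum_comm]
  simp [contractionTensor]

theorem sum_mul_contractionTensor (κ : ℕ) {n : ℕ} (s : Fin n → ℕ)
    (φ : Fin (κ * ∑ i, s i) → ℂ) (p : GIndex κ s × (∀ i, Fin (κ * s i))) :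
    ∑ μ, φ μ * contractionTensor κ s μ p = if p.1.2 = p.2 then φ p.1.1 else 0 := by
  simp only [contractionTensor, Prod.ext_iff, mul_ite, mul_one, mul_zero]
  split_ifs with h <;> simp [h]

/-- The quadratic phases of the parts cancel. What is left is πi(μ² + μ) minus the sum of the πi(mᵢ²
+ mᵢ), an element of 2πiℤ because x(x + 1) is even. -/
theorem multG_T_mul_prod (κ : ℕ) (hκ : 0 < κ) (c₂ : ℤ) {n : ℕ} (s : Fin n → ℕ)
    (hs : ∀ i, 0 < s i) (μ : Fin (κ * ∑ i, s i)) (m : ∀ i, Fin (κ * s i)) :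
    (multG κ s).T (μ, m) (μ, m) * ∏ i, (multH κ c₂ (s i)).T (m i) (m i) =
      (multH κ c₂ (∑ i, s i)).T μ μ := by
  simp only [multG, multH, Matrix.of_apply, if_true]
  rw [← Complex.exp_sum, ← Complex.exp_add, Complex.exp_eq_exp_iff_exists_int]
  have hκ' : (κ : ℂ) ≠ 0 := by exact_mod_cast hκ.ne'
  have hs' : ∀ i, (s i : ℂ) ≠ 0 := fun i => by exact_mod_cast (hs i).ne'
  have hμ : ((∑ i, s i : ℕ) : ℂ) ≠ 0 := by
    have := μ.pos
    have : (∑ i, s i : ℕ) ≠ 0 := by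
      intro h
      simp [h] at this
    exact_mod_cast this
  obtain ⟨A, hA⟩ : ∃ A : ℕ, (μ : ℕ) * ((μ : ℕ) + 1) = A + A := Nat.even_mul_succ_self _
  choose B hB using fun i => (Nat.even_mul_succ_self (m i) : ∃ B : ℕ, _ = B + B)
  -- `A` and `B i` are the halves of μ(μ + 1) and mᵢ(mᵢ + 1).
  refine ⟨(A : ℤ) - ∑ i, (B i : ℤ), ?_⟩
  have hA' : ((μ : ℕ) : ℂ) * ((μ : ℕ) + 1) = A + A := by exact_mod_cast hA
  have hB' : ∀ i, ((m i : ℕ) : ℂ) * ((m i : ℕ) + 1) = B i + B i := fun i => by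
    exact_mod_cast hB i
  have e1 : ∀ i, (Real.pi * Complex.I / (κ * s i) * (1 - κ * s i) * ((m i : ℕ) : ℂ) ^ 2 +
      Real.pi * Complex.I / 4 * (κ + c₂ / 3) * s i : ℂ) =
      Real.pi * Complex.I * (((m i : ℕ) : ℂ) ^ 2 / (κ * s i)) + Real.pi * Complex.I * (m i : ℕ)
        - 2 * Real.pi * Complex.I * B i + Real.pi * Complex.I / 4 * (κ + c₂ / 3) * s i := by
    intro i
    have h1 : ((m i : ℕ) : ℂ) ^ 2 = B i + B i - (m i : ℕ) := by rw [← hB' i]; ring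
    have := hs' i
    have h2 : (Real.pi * Complex.I / (κ * s i) * (1 - κ * s i) * ((m i : ℕ) : ℂ) ^ 2 : ℂ) =
      Real.pi * Complex.I * (((m i : ℕ) : ℂ) ^ 2 / (κ * s i)) -
        Real.pi * Complex.I * ((m i : ℕ) : ℂ) ^ 2 := by field_simp
    rw [h2]
    linear_combination (-Real.pi * Complex.I : ℂ) * h1
  have e2 : (Real.pi * Complex.I / (κ * (∑ i, s i : ℕ)) * (1 - κ * (∑ i, s i : ℕ)) *
      ((μ : ℕ) : ℂ) ^ 2 : ℂ) = Real.pi * Complex.I * (((μ : ℕ) : ℂ) ^ 2 / (κ * (∑ i, s i : ℕ))) -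
        Real.pi * Complex.I * ((μ : ℕ) : ℂ) ^ 2 := by field_simp
  simp only [e1, e2, Finset.sum_add_distrib, Finset.sum_sub_distrib, ← Finset.mul_sum]
  push_cast
  linear_combination (Real.pi * Complex.I : ℂ) * hA'

/-- Isolates the dependence on the contracted index `x` as a product of characters, ready for
orthogonality in each factor. In the eighth roots of unity, the n - 1 from `multG` and the -1 from
each of the `n` factors `multH` add up to the single -1 of the total charge. -/
theorem multG_S_mul_prod (κ : ℕ) (c₂ : ℤ) {n : ℕ} (s : Fin n → ℕ)
    (μ ν : Fin (κ * ∑ i, s i)) (x m m' : ∀ i, Fin (κ * s i)) :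
    (multG κ s).S (μ, x) (ν, m) * ∏ i, (multH κ c₂ (s i)).S (x i) (m' i) =
      Complex.exp (Real.pi * Complex.I / 4 * ((2 * κ + c₂) * (∑ i, s i : ℕ) - 1)) /
        (Real.sqrt (κ ^ (n + 1) * (∑ i, s i : ℕ) * ∏ i, (s i : ℝ)) *
          ∏ i, (Real.sqrt (κ * s i) : ℂ)) *
      Complex.exp (-2 * Real.pi * Complex.I * ((μ : ℕ) * (ν : ℕ) / (κ * (∑ i, s i : ℕ)))) *
      ∏ i, (Complex.exp (2 * Real.pi * Complex.I * ((x i : ℕ) * (m i : ℕ) / (κ * s i : ℕ))) *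
        Complex.exp (-2 * Real.pi * Complex.I * ((x i : ℕ) * (m' i : ℕ) / (κ * s i : ℕ)))) := by
  simp only [multG, multH, Matrix.of_apply, Finset.prod_mul_distrib, Finset.prod_div_distrib]
  have h1 : Complex.exp (Real.pi * Complex.I / 4 * ((2 * κ + c₂) * (∑ i, s i : ℕ) - 1)) =
      Complex.exp (Real.pi * Complex.I / 4 * (n - 1)) *
        ∏ i, Complex.exp (Real.pi * Complex.I / 4 * ((2 * κ + c₂) * s i - 1)) := by
    rw [← Complex.exp_sum, ← Complex.exp_add, ← Finset.mul_sum, Finset.sum_sub_distrib,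
      ← Finset.mul_sum]
    congr 1
    push_cast
    simp
    ring
  have h2 : Complex.exp (-2 * Real.pi * Complex.I *
        ((μ : ℕ) * (ν : ℕ) / (κ * (∑ i, s i : ℕ)) -
          ∑ i, ((x i : ℕ) : ℂ) * (m i : ℕ) / (κ * s i))) =
      Complex.exp (-2 * Real.pi * Complex.I * ((μ : ℕ) * (ν : ℕ) / (κ * (∑ i, s i : ℕ)))) *
      ∏ i, Complex.exp (2 * Real.pi * Complex.I * ((x i : ℕ) * (m i : ℕ) / (κ * s i : ℕ))) := by
    rw [← Complex.exp_sum, ← Complex.exp_add, ← Finset.mul_sum]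
    congr 1
    push_cast
    ring
  rw [h1, h2]
  push_cast
  ring

/-- Normalization left over after orthogonality, which produces the factor ∏ κsᵢ. It rests on κⁿ⁺¹
(∑ sᵢ) ∏ sᵢ = (κ ∑ sᵢ) ∏ (κsᵢ). -/
theorem sqrt_mul_prod_sqrt (κ : ℕ) (hκ : 0 < κ) {n : ℕ} (s : Fin n → ℕ)
    (hs : ∀ i, 0 < s i) :
    (∏ i, (κ * s i : ℝ)) / (Real.sqrt (κ ^ (n + 1) * (∑ i, s i : ℕ) * ∏ i, (s i : ℝ)) *
      ∏ i, Real.sqrt (κ * s i)) = 1 / Real.sqrt (κ * (∑ i, s i : ℕ)) := by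
  have hP : 0 < ∏ i, (κ * s i : ℝ) :=
    Finset.prod_pos fun i _ => mul_pos (by exact_mod_cast hκ) (by exact_mod_cast hs i)
  have h1 : (κ ^ (n + 1) * (∑ i, s i : ℕ) * ∏ i, (s i : ℝ) : ℝ) =
      (κ * (∑ i, s i : ℕ)) * ∏ i, (κ * s i : ℝ) := by
    rw [Finset.prod_mul_distrib, Finset.prod_const, Finset.card_univ, Fintype.card_fin]
    ring
  have h2 : ∏ i, Real.sqrt (κ * s i) = Real.sqrt (∏ i, (κ * s i : ℝ)) :=
    (Real.sqrt_prod _ fun i _ => by positivity).symm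
  rw [h1, h2, Real.sqrt_mul (by positivity), mul_assoc, Real.mul_self_sqrt hP.le]
  rw [div_mul_eq_div_div_swap, div_self hP.ne']

/-- Both sides vanish unless the residues `m` of the coefficient agree with the residues `m'` of the
product. For T all matrices are diagonal; for S the sum over the contracted residues enforces m =
m'. -/
theorem multH_intertwines (κ : ℕ) (hκ : 0 < κ) (c₂ : ℤ) {n : ℕ} (s : Fin n → ℕ)
    (hs : ∀ i, 0 < s i) :
    (multH κ c₂ (∑ i, s i)).Intertwines
      ((multG κ s).tensor (MultiplierSystem.pi fun i => multH κ c₂ (s i)))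
      (contractionTensor κ s) := by
  refine ⟨fun μ p => ?_, fun μ p => ?_⟩ <;>
    rw [sum_contractionTensor_mul, sum_mul_contractionTensor] <;>
    obtain ⟨⟨ν, m⟩, m'⟩ := p <;>
    simp only [MultiplierSystem.tensor, MultiplierSystem.pi, Matrix.of_apply]
  · by_cases hμ : μ = ν
    · subst hμ
      rw [Fintype.sum_eq_single m]
      · by_cases hm : m = m'
        · subst hm
          rw [if_pos rfl, multG_T_mul_prod κ hκ c₂ s hs]
        · obtain ⟨i, hi⟩ := Function.ne_iff.mp hm
          rw [if_neg hm, Finset.prod_eq_zero (Finset.mem_univ i), mul_zero]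
          simp [multH, hi]
      · intro x hx
        simp [multG, hx]
    · simp [multG, multH, hμ]
  · have orth : ∑ x : ∀ i, Fin (κ * s i), ∏ i,
        (Complex.exp (2 * Real.pi * Complex.I * ((x i : ℕ) * (m i : ℕ) / (κ * s i : ℕ))) *
          Complex.exp (-2 * Real.pi * Complex.I * ((x i : ℕ) * (m' i : ℕ) / (κ * s i : ℕ)))) =
        ∏ i, if m i = m' i then ((κ * s i : ℕ) : ℂ) else 0 := by
      simp only [← sum_exp_mul_exp_neg, Fintype.prod_sum]
    simp only [multG_S_mul_prod, ← Finset.mul_sum]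
    rw [orth]
    by_cases hm : m = m'
    · subst hm
      simp only [if_true, multH, Matrix.of_apply]
      have h := congrArg (fun x : ℝ => (x : ℂ)) (sqrt_mul_prod_sqrt κ hκ s hs)
      push_cast at h ⊢
      linear_combination (-(Complex.exp (Real.pi * Complex.I / 4 *
        ((2 * κ + c₂) * (∑ i, (s i : ℂ)) - 1)) * Complex.exp (-2 * Real.pi * Complex.I *
          ((μ : ℕ) * (ν : ℕ) / (κ * ∑ i, (s i : ℂ)))))) * h
    · obtain ⟨i, hi⟩ := Function.ne_iff.mp hm
      have hz : ∏ i, (if m i = m' i then ((κ * s i : ℕ) : ℂ) else 0) = 0 :=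
        Finset.prod_eq_zero (Finset.mem_univ i) (if_neg hi)
      rw [if_neg hm, hz, mul_zero]

/-- Multiplying anomalous coefficients with depth zero generating functions. -/
theorem IsPolarizedCompletion.mul_prod_residues {κ : ℕ} (hκ : 0 < κ) {c₂ : ℤ}
    {h₀ : ℕ → ℕ → ℍ → ℂ}
    (h₀_modular : ∀ r : ℕ, 0 < r → IsModularForm (-3) (multH κ c₂ r) (fun μ τ => h₀ r μ τ))
    {n d : ℕ} {s : Fin n → ℕ} (hs : ∀ i, 0 < s i) {f : GIndex κ s → ℍ → ℂ}
    {F : GIndex κ s → ℍ → ℍ → ℂ}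
    (hF : IsPolarizedCompletion d (3 * ((n : ℤ) - 1)) (multG κ s) f F) :
    IsPolarizedCompletion d (-3) (multH κ c₂ (∑ i, s i))
      (fun μ τ => ∑ m, f (μ, m) τ * ∏ i, h₀ (s i) (m i) τ)
      (fun μ τ z => ∑ m, F (μ, m) τ z * ∏ i, h₀ (s i) (m i) τ) := by
  have h := (hF.tensor (IsModularForm.pi fun i => h₀_modular (s i) (hs i))).contract
    (multH_intertwines κ hκ c₂ s hs)
  simp only [sum_contractionTensor_mul] at h
  convert h using 1
  -- Twice the weights: 3(n - 1) + n(-3) = -3.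
  ring

/-! ### Sums over compositions -/

/-- Compares tuples whose lengths are only propositionally equal, without heterogeneous equality. -/
theorem sigma_fin_ext {X : Type*} {p q : Σ n, Fin n → X} (h : p.1 = q.1)
    (hX : ∀ i : Fin q.1, p.2 ⟨i, h.symm ▸ i.2⟩ = q.2 i) : p = q := by
  obtain ⟨n, a⟩ := p
  obtain ⟨m, b⟩ := q
  obtain rfl : n = m := h
  exact congrArg _ (funext hX)

/-- The ordered decompositions of `r` into `n` positive integers. -/
def positiveTuples (r n : ℕ) : Finset (Fin n → ℕ) :=
  (Finset.piAntidiag Finset.univ r).filter fun s => ∀ i, 0 < s i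

theorem mem_positiveTuples {r n : ℕ} {s : Fin n → ℕ} :
    s ∈ positiveTuples r n ↔ ∑ i, s i = r ∧ ∀ i, 0 < s i := by
  simp [positiveTuples]

/-- Grouping compositions by length lets the symmetric group on `n` letters act on the parts at
fixed `n`. Positivity of the parts bounds the length by `r`. -/
theorem sum_composition_eq_sum_positiveTuples {X : Type*} [AddCommMonoid X] (r : ℕ)
    (Y : ∀ n : ℕ, (Fin n → ℕ) → X) :
    ∑ c : Composition r, Y c.length c.blocksFun =
      ∑ n ∈ Finset.range (r + 1), ∑ s ∈ positiveTuples r n, Y n s := by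
  rw [Finset.sum_sigma']
  refine Finset.sum_bij (fun c _ => ⟨c.length, c.blocksFun⟩) (fun c _ => ?_)
    (fun c _ c' _ h => ?_) (fun p hp => ?_) fun _ _ => rfl
  · simp only [Finset.mem_sigma, Finset.mem_range, mem_positiveTuples]
    exact ⟨Nat.lt_succ_of_le c.length_le, c.sum_blocksFun, c.one_le_blocksFun⟩
  · have := congrArg (fun p : Σ n, Fin n → ℕ => List.ofFn p.2) h
    simp only [Composition.ofFn_blocksFun] at this
    exact Composition.ext this
  · obtain ⟨n, s⟩ := p
    simp only [Finset.mem_sigma, mem_positiveTuples] at hp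
    obtain ⟨-, hsum, hpos⟩ := hp
    refine ⟨⟨List.ofFn s, ?_, ?_⟩, Finset.mem_univ _, ?_⟩
    · simp only [List.mem_ofFn, forall_exists_index]
      rintro _ i rfl
      exact hpos i
    · rw [List.sum_ofFn, hsum]
    · exact sigma_fin_ext (by simp [Composition.length])
        fun i => by simp [Composition.blocksFun]

/-- Symmetrizing does not change a sum over all compositions. -/
theorem sum_composition_symmetrize (r : ℕ) (Y : ∀ n : ℕ, (Fin n → ℕ) → ℂ) :
    ∑ c : Composition r, (1 / (c.length.factorial : ℂ)) *
        ∑ σ : Equiv.Perm (Fin c.length), Y c.length (fun i => c.blocksFun (σ i)) =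
      ∑ c : Composition r, Y c.length c.blocksFun := by
  rw [sum_composition_eq_sum_positiveTuples r fun n s => (1 / (n.factorial : ℂ)) *
        ∑ σ : Equiv.Perm (Fin n), Y n (fun i => s (σ i)),
    sum_composition_eq_sum_positiveTuples]
  refine Finset.sum_congr rfl fun n _ => ?_
  rw [← Finset.mul_sum, Finset.sum_comm]
  -- Each permutation maps the set of positive tuples of sum `r` bijectively to itself, so the
  -- average is over n! equal sums.
  have h : ∀ σ : Equiv.Perm (Fin n), ∑ s ∈ positiveTuples r n, Y n (fun i => s (σ i)) =
      ∑ s ∈ positiveTuples r n, Y n s := by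
    intro σ
    refine Finset.sum_equiv (Equiv.arrowCongr σ.symm (Equiv.refl ℕ)) (fun s => ?_) fun s _ => ?_
    · simp only [mem_positiveTuples, Equiv.arrowCongr_apply, Equiv.symm_symm, Equiv.coe_refl,
        Function.comp_apply, id]
      rw [Equiv.sum_comp σ s, σ.forall_congr_right (q := fun i => 0 < s i)]
    · rfl
  simp only [h, Finset.sum_const, Finset.card_univ, Fintype.card_perm, Fintype.card_fin,
    nsmul_eq_mul]
  have : (n.factorial : ℂ) ≠ 0 := by exact_mod_cast n.factorial_ne_zero
  field_simp

theorem sum_residues_perm {X : Type*} [AddCommMonoid X] (κ : ℕ) {n : ℕ} (s : Fin n → ℕ)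
    (σ : Equiv.Perm (Fin n)) (φ : (Fin n → ℕ) → X) :
    ∑ m ∈ residues κ s, φ (fun i => m (σ i)) =
      ∑ m ∈ residues κ (fun i => s (σ i)), φ m := by
  refine Finset.sum_equiv (Equiv.arrowCongr σ.symm (Equiv.refl ℕ)) (fun m => ?_) fun m _ => ?_
  · simp only [residues, Fintype.mem_piFinset, Finset.mem_range, Equiv.arrowCongr_apply,
      Equiv.symm_symm, Equiv.coe_refl, Function.comp_apply, id]
    rw [σ.forall_congr_right (q := fun i => m i < κ * s i)]
  · rfl

/-- A sum over residues of a product over the blocks of a composition. -/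
theorem sum_residues_prod_blocks (κ : ℕ) {n : ℕ} (s : Fin n → ℕ) (d : Composition n)
    (φ : ∀ k : Fin d.length, (Fin (d.blocksFun k) → ℕ) → ℂ) :
    ∑ m ∈ residues κ s, ∏ k, φ k (fun i => m (d.embedding k i)) =
      ∏ k, ∑ m ∈ residues κ (fun i => s (d.embedding k i)), φ k m := by
  rw [Finset.prod_univ_sum]
  -- A tuple on `Fin n` is cut into its restrictions to the blocks of `d`.
  refine Finset.sum_equiv ((Equiv.arrowCongr d.blocksFinEquiv.symm (Equiv.refl ℕ)).trans
    (Equiv.piCurry fun _ _ => ℕ)) (fun m => ?_) fun m _ => ?_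
  · simp only [residues, Fintype.mem_piFinset, Finset.mem_range]
    rw [← d.blocksFinEquiv.forall_congr_right, Sigma.forall]
    rfl
  · rfl

/-- The sum over residues of the products of the functions `g` and `h`. -/
noncomputable def residueSum (κ : ℕ) (g : ∀ n : ℕ, (Fin n → ℕ) → ℕ → (Fin n → ℕ) → ℍ → ℂ)
    (h : ℕ → ℕ → ℍ → ℂ) (τ : ℍ) (ν : ℕ) (p : Σ n, Fin n → ℕ) : ℂ :=
  ∑ m ∈ residues κ p.2, g p.1 p.2 ν m τ * ∏ i, h (p.2 i) (m i) τ

/-- The contribution to the completion of a decomposition into blocks of charges. -/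
noncomputable def blockTerm (κ : ℕ) (g : ∀ n : ℕ, (Fin n → ℕ) → ℕ → (Fin n → ℕ) → ℍ → ℂ)
    (h : ℕ → ℕ → ℍ → ℂ) (μ : ℕ) (τ : ℍ) (p : Σ n, Fin n → Σ l, Fin l → ℕ) : ℂ :=
  ∑ ν ∈ residues κ (fun k => ∑ i, (p.2 k).2 i),
    thetaR κ (fun k => ∑ i, (p.2 k).2 i) μ ν τ * ∏ k, residueSum κ g h τ (ν k) (p.2 k)

/-- Expanding the product over the blocks chooses a composition of each block independently. -/
theorem completionH_chargeSum (κ : ℕ)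
    (g : ∀ n : ℕ, (Fin n → ℕ) → ℕ → (Fin n → ℕ) → ℍ → ℂ) (h : ℕ → ℕ → ℍ → ℂ) (r μ : ℕ) (τ : ℍ) :
    completionH κ (chargeSum κ g h) r μ τ =
      ∑ x : Σ c : Composition r, ∀ i : Fin c.length, Composition (c.blocksFun i),
        blockTerm κ g h μ τ ⟨x.1.length, fun k => ⟨(x.2 k).length, (x.2 k).blocksFun⟩⟩ := by
  rw [Fintype.sum_sigma]
  simp only [completionH, chargeSum, blockTerm, residueSum, Composition.sum_blocksFun]
  refine Finset.sum_congr rfl fun c _ => ?_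
  rw [Finset.sum_comm]
  refine Finset.sum_congr rfl fun ν _ => ?_
  rw [← Finset.mul_sum, Finset.prod_univ_sum, Fintype.piFinset_univ]

/-- At fixed `d` and `ν` both the product of the `g` and the product of the `h` factor over the
blocks of `d`, hence so does the sum over residues. -/
theorem sum_completionGUnsym (κ : ℕ)
    (g : ∀ n : ℕ, (Fin n → ℕ) → ℕ → (Fin n → ℕ) → ℍ → ℂ) (h : ℕ → ℕ → ℍ → ℂ) {n : ℕ}
    (s : Fin n → ℕ) (μ : ℕ) (τ : ℍ) :
    ∑ m ∈ residues κ s, completionGUnsym κ g s μ m τ * ∏ i, h (s i) (m i) τ =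
      ∑ d : Composition n, blockTerm κ g h μ τ
        ⟨d.length, fun k => ⟨d.blocksFun k, fun i => s (d.embedding k i)⟩⟩ := by
  simp only [completionGUnsym, Finset.sum_mul]
  rw [Finset.sum_comm]
  refine Finset.sum_congr rfl fun d _ => ?_
  rw [Finset.sum_comm]
  refine Finset.sum_congr rfl fun ν _ => ?_
  simp only [residueSum]
  rw [← sum_residues_prod_blocks κ s d fun k m => g (d.blocksFun k)
    (fun i => s (d.embedding k i)) (ν k) m τ * ∏ i, h (s (d.embedding k i)) (m i) τ,
    Finset.mul_sum]
  refine Finset.sum_congr rfl fun m _ => ?_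
  rw [Finset.prod_mul_distrib, d.prod_prod_apply_embedding fun i => h (s i) (m i) τ, mul_assoc]

/-- Gathering the parts of `c` along `d` and then splitting each gathered block recovers the parts
of `c` grouped by `d`. Stated for plain nested tuples, so that `blockTerm` can be rewritten by
equality. -/
theorem blocks_sigmaEquivSigmaPi {r : ℕ} (c : Composition r) (d : Composition c.length) :
    (⟨(c.gather d).length, fun k => ⟨(c.sigmaCompositionAux d k).length,
      (c.sigmaCompositionAux d k).blocksFun⟩⟩ : Σ n, Fin n → Σ l, Fin l → ℕ) =
    ⟨d.length, fun k => ⟨d.blocksFun k, fun i => c.blocksFun (d.embedding k i)⟩⟩ :=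
  sigma_fin_ext (Composition.length_gather c d) fun k =>
    sigma_fin_ext (Composition.length_sigmaCompositionAux c d k) fun i =>
      Composition.blocksFun_sigmaCompositionAux c d k i

/-- The product of the `h` is invariant under simultaneous permutation of charges and residues, so
it can be moved inside the symmetrization. -/
theorem sum_symmetrize_mul_prod (κ : ℕ) {n : ℕ} (U : (Fin n → ℕ) → (Fin n → ℕ) → ℂ)
    (h : ℕ → ℕ → ℂ) (s : Fin n → ℕ) (a : ℂ) :
    ∑ m ∈ residues κ s, (a * ∑ σ : Equiv.Perm (Fin n), U (fun i => s (σ i)) fun i => m (σ i)) *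
        ∏ i, h (s i) (m i) =
      a * ∑ σ : Equiv.Perm (Fin n), ∑ m ∈ residues κ (fun i => s (σ i)),
        U (fun i => s (σ i)) m * ∏ i, h (s (σ i)) (m i) := by
  simp only [mul_assoc, ← Finset.mul_sum, Finset.sum_mul]
  rw [Finset.sum_comm]
  refine congrArg (a * ·) (Finset.sum_congr rfl fun σ _ => ?_)
  rw [← sum_residues_perm κ s σ fun m => U (fun i => s (σ i)) m * ∏ i, h (s (σ i)) (m i)]
  refine Finset.sum_congr rfl fun m _ => ?_
  rw [Equiv.prod_comp σ fun i => h (s i) (m i)]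

/-- The completion of the generating functions in terms of the completions of the anomalous
coefficients. -/
theorem completionH_chargeSum_eq_sum_completionG (κ : ℕ)
    (g : ∀ n : ℕ, (Fin n → ℕ) → ℕ → (Fin n → ℕ) → ℍ → ℂ) (h : ℕ → ℕ → ℍ → ℂ) (r μ : ℕ) (τ : ℍ) :
    completionH κ (chargeSum κ g h) r μ τ = ∑ c : Composition r, ∑ m ∈ residues κ c.blocksFun,
      completionG κ g c.blocksFun μ m τ * ∏ i, h (c.blocksFun i) (m i) τ := by
  have hsym : ∀ c : Composition r, ∑ m ∈ residues κ c.blocksFun,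
      completionG κ g c.blocksFun μ m τ * ∏ i, h (c.blocksFun i) (m i) τ =
      (1 / (c.length.factorial : ℂ)) * ∑ σ : Equiv.Perm (Fin c.length),
        ∑ d : Composition c.length, blockTerm κ g h μ τ
          ⟨d.length, fun k => ⟨d.blocksFun k, fun i => c.blocksFun (σ (d.embedding k i))⟩⟩ := by
    intro c
    rw [← Finset.sum_congr rfl fun (σ : Equiv.Perm (Fin c.length)) _ =>
      sum_completionGUnsym κ g h (fun i => c.blocksFun (σ i)) μ τ]
    exact sum_symmetrize_mul_prod κ (fun s m => completionGUnsym κ g s μ m τ) (fun s m => h s m τ)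
      c.blocksFun _
  rw [Finset.sum_congr rfl fun c _ => hsym c,
    sum_composition_symmetrize r fun n s => ∑ d : Composition n, blockTerm κ g h μ τ
      ⟨d.length, fun k => ⟨d.blocksFun k, fun i => s (d.embedding k i)⟩⟩,
    completionH_chargeSum, ← (Composition.sigmaEquivSigmaPi r).sum_comp, Fintype.sum_sigma]
  refine Finset.sum_congr rfl fun c _ => Finset.sum_congr rfl fun d _ => ?_
  exact congrArg _ (blocks_sigmaEquivSigmaPi c d)

/-- The contribution of a fixed decomposition of the charge to the generating functions. -/
theorem exists_completion_residueSum {κ : ℕ} (hκ : 0 < κ) {c₂ : ℤ} {h₀ : ℕ → ℕ → ℍ → ℂ}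
    (h₀_modular : ∀ r : ℕ, 0 < r → IsModularForm (-3) (multH κ c₂ r) (fun μ τ => h₀ r μ τ))
    {n r d : ℕ} {s : Fin n → ℕ} (hs : ∀ i, 0 < s i) (hr : ∑ i, s i = r)
    {f fHat : ℕ → (Fin n → ℕ) → ℍ → ℂ}
    (hf : IsMockModular d (3 * ((n : ℤ) - 1)) (multG κ s)
        (fun p τ => f p.1 (fun i => p.2 i) τ) (fun p τ => fHat p.1 (fun i => p.2 i) τ)) :
    IsMockModular d (-3) (multH κ c₂ r)
      (fun μ τ => ∑ m ∈ residues κ s, f μ m τ * ∏ i, h₀ (s i) (m i) τ)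
      (fun μ τ => ∑ m ∈ residues κ s, fHat μ m τ * ∏ i, h₀ (s i) (m i) τ) := by
  -- The index types `Fin (κ * ∑ i, s i)` and `Fin (κ * r)` must coincide definitionally.
  subst hr
  obtain ⟨F, hF, hFf⟩ := hf
  simp only [sum_residues]
  exact ⟨_, hF.mul_prod_residues hκ h₀_modular hs, fun μ τ =>
    Finset.sum_congr rfl fun m _ => by rw [← hFf (μ, m) τ]⟩

end AnomalousCoeff

theorem mainTheorem1 (κ : ℕ) (hκ : 0 < κ) (c₂ : ℤ)
    (h₀ : ℕ → ℕ → ℍ → ℂ)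
    (g : ∀ n : ℕ, (Fin n → ℕ) → ℕ → (Fin n → ℕ) → ℍ → ℂ)
    (h₀_modular : ∀ r : ℕ, 0 < r →
      IsModularForm (-3) (multH κ c₂ r) (fun μ τ => h₀ r μ τ))
    (g_one : ∀ r : ℕ, 0 < r → ∀ μ < κ * r, ∀ μ' < κ * r, ∀ τ : ℍ,
      g 1 (fun _ => r) μ (fun _ => μ') τ = if μ = μ' then 1 else 0)
    (g_mock : ∀ n : ℕ, 0 < n → ∀ r : Fin n → ℕ, (∀ i, 0 < r i) →
      IsMockModular (n - 1) (3 * ((n : ℤ) - 1)) (multG κ r)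
        (fun p τ => g n r p.1 (fun i => p.2 i) τ)
        (fun p τ => completionG κ g r p.1 (fun i => p.2 i) τ))
    (r : ℕ) (hr : 0 < r) :
    IsMockModular (r - 1) (-3) (multH κ c₂ r)
      (fun μ τ => chargeSum κ g h₀ r μ τ)
      (fun μ τ => completionH κ (chargeSum κ g h₀) r μ τ) := by
  choose F hF hFdiag using fun c : Composition r =>
    exists_completion_residueSum hκ h₀_modular c.one_le_blocksFun c.sum_blocksFun
      (g_mock c.length (c.length_pos_of_pos hr) c.blocksFun c.one_le_blocksFun)
  -- A composition of `r` has at most `r` parts, so every summand can be raised to the common depth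
  -- r - 1.
  refine ⟨_, IsPolarizedCompletion.sum fun c =>
    (hF c).mono (Nat.sub_le_sub_right c.length_le 1), fun μ τ => ?_⟩
  beta_reduce
  rw [completionH_chargeSum_eq_sum_completionG]
  exact Finset.sum_congr rfl fun c _ => hFdiag c μ τ
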